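/- Let $n\ge 1$. Write $|\cdot|$ for the supremum norm and $\|\cdot\|$ for the distance to the nearest integer (for vectors in $\mathbb R^n$: the supremum-norm distance to the nearest point of $\mathbb Z^n$). For $\mathbf x,\boldsymbol\theta\in\mathbb R^n$ define, with values in the extended reals, $$w_0(\mathbf x)=\sup\{w:\|q\mathbf x\|<q^{-w}\text{ for infinitely many }q\in\mathbb N\},$$ $$w_{n-1}(\mathbf x)=\sup\{w:\|\mathbf q\cdot\mathbf x\|<|\mathbf q|^{-w}\text{ for infinitely many }\mathbf q\in\mathbb Z^n\setminus\{0\}\},$$ $$w_0(\mathbf x,\boldsymbol\theta)=\sup\{w\ge 0:\|q\mathbf x+\boldsymbol\theta\|<|q|^{-w}\text{ for infinitely many }q\in\mathbb Z\setminus\{0\}\}.$$ Let $M$ be a differentiable submanifold of $\mathbb R^n$ of dimension $d\ge 1$: every point of $M$ lies in a relatively open subset of $M$ that is the homeomorphic image of an open set $U\subset\mathbb R^d$ under a map that is differentiable with injective derivative at each point of $U$. "Almost every point of $M$" refers to the Lebesgue measure induced on $M$, i.e. the exceptional set corresponds to a Lebesgue null set in every such local parameterisation. Call $M$ extremal if $w_0(\mathbf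 x)=\frac1n$ and $w_{n-1}(\mathbf x)=n$ for almost every $\mathbf x\in M$, and simultaneously inhomogeneously extremal (SIE) if for every $\boldsymbol\theta\in\mathbb R^n$ one has $w_0(\mathbf x,\boldsymbol\theta)=\frac1n$ for almost every $\mathbf x\in M$. **Theorem.** $M$ is extremal if and only if $M$ is SIE. Moreover, the same equivalence holds when extremality is understood through the simultaneous exponent alone: $w_0(\mathbf x)=\frac1n$ for almost every $\mathbf x\in M$ if and only if $M$ is SIE. -/

import Mathlib

open MeasureTheory

/-- The distance, in the supremum norm, from `y` in `ℝⁿ` to the nearest point of `ℤⁿ`. -/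
noncomputable def distNearestInt {n : ℕ} (y : Fin n → ℝ) : ℝ :=
  ‖fun i => y i - round (y i)‖

/-- The simultaneous Diophantine exponent of `x`, an extended real number (it may be `+∞`). -/
noncomputable def simulExponent {n : ℕ} (x : Fin n → ℝ) : EReal :=
  sSup {e : EReal | ∃ w : ℝ, e = (w : EReal) ∧
    {q : ℕ | q ≠ 0 ∧ distNearestInt ((q : ℝ) • x) < (q : ℝ) ^ (-w)}.Infinite}

/-- The dual Diophantine exponent of `x`: here `‖q‖` is the supremum norm of the integer
vector `q`, and `|t - round t|` is the distance from `t` to the nearest integer. -/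
noncomputable def dualExponent {n : ℕ} (x : Fin n → ℝ) : EReal :=
  sSup {e : EReal | ∃ w : ℝ, e = (w : EReal) ∧
    {q : Fin n → ℤ | q ≠ 0 ∧
      |(∑ i, (q i : ℝ) * x i) - round (∑ i, (q i : ℝ) * x i)| < ‖q‖ ^ (-w)}.Infinite}

/-- The simultaneous inhomogeneous Diophantine exponent of `x` with respect to `θ`. -/
noncomputable def inhomExponent {n : ℕ} (x θ : Fin n → ℝ) : EReal :=
  sSup {e : EReal | ∃ w : ℝ, 0 ≤ w ∧ e = (w : EReal) ∧
    {q : ℤ | q ≠ 0 ∧ distNearestInt ((q : ℝ) • x + θ) < |(q : ℝ)| ^ (-w)}.Infinite}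

/-- `φ`, restricted to the open set `U` of `ℝᵈ`, is a local parameterisation of the subset `M`
of `ℝⁿ`: it is differentiable with injective derivative at each point of `U`, and it is a
homeomorphism from `U` onto a relatively open subset of `M`. -/
structure IsLocalParam {n d : ℕ} (M : Set (Fin n → ℝ)) (U : Set (Fin d → ℝ))
    (φ : (Fin d → ℝ) → (Fin n → ℝ)) : Prop where
  isOpen : IsOpen U
  differentiableAt : ∀ u ∈ U, DifferentiableAt ℝ φ u
  injective_fderiv : ∀ u ∈ U, Function.Injective (fderiv ℝ φ u)
  isEmbedding : Topology.IsEmbedding (fun u : U => φ u)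
  image_eq : ∃ V : Set (Fin n → ℝ), IsOpen V ∧ φ '' U = M ∩ V

/-- `M` is a `d`-dimensional (embedded) differentiable submanifold of `ℝⁿ`. -/
def IsDifferentiableSubmanifold {n : ℕ} (d : ℕ) (M : Set (Fin n → ℝ)) : Prop :=
  ∀ x ∈ M, ∃ (U : Set (Fin d → ℝ)) (φ : (Fin d → ℝ) → (Fin n → ℝ)),
    IsLocalParam M U φ ∧ x ∈ φ '' U

/-- `P` holds at almost every point of the `d`-dimensional submanifold `M`: the set of points
of `M` where `P` fails has `d`-dimensional Lebesgue measure zero in every local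
parameterisation (these are the null sets of the Lebesgue measure induced on `M`). -/
def AlmostEverywhereOn {n : ℕ} (d : ℕ) (M : Set (Fin n → ℝ)) (P : (Fin n → ℝ) → Prop) : Prop :=
  ∀ (U : Set (Fin d → ℝ)) (φ : (Fin d → ℝ) → (Fin n → ℝ)), IsLocalParam M U φ →
    ∀ᵐ u ∂((volume : Measure (Fin d → ℝ)).restrict U), P (φ u)

/-- Extremality: both the simultaneous and the dual exponent take their generic values at almost
every point of `M`. -/
def IsExtremal {n : ℕ} (d : ℕ) (M : Set (Fin n → ℝ)) : Prop :=
  AlmostEverywhereOn d M fun x =>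
    simulExponent x = ((1 / (n : ℝ) : ℝ) : EReal) ∧ dualExponent x = ((n : ℝ) : EReal)

/-- Extremality, in terms of the simultaneous exponent alone. -/
def IsSimulExtremal {n : ℕ} (d : ℕ) (M : Set (Fin n → ℝ)) : Prop :=
  AlmostEverywhereOn d M fun x => simulExponent x = ((1 / (n : ℝ) : ℝ) : EReal)

/-- Simultaneous inhomogeneous extremality. -/
def IsSIE {n : ℕ} (d : ℕ) (M : Set (Fin n → ℝ)) : Prop :=
  ∀ θ : Fin n → ℝ, AlmostEverywhereOn d M fun x =>
    inhomExponent x θ = ((1 / (n : ℝ) : ℝ) : EReal)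

open Filter Topology Asymptotics

/-! The heart is the upper bound for the inhomogeneous exponent. Fix `v < w` with simultaneous
exponent below `v`, and a dyadic range `S ≤ |q| < 2S`. If two nearby points `x, x'` approximate the
same `θ` to within `S^(-w)` with denominators `q, q'`, subtraction removes `θ` and makes `(q - q')x`
close to an integer point. As `x` is not that well approximable, `q = q'`, so `x` and `x'` are
extremely close (`dist_le_of_notApproximable`). The bad set thus lies in clusters of diameter about
`S^(-w-1)` separated by about `S^(-v-1)`, of measure `O(S^((v-w)d))`; Borel–Cantelli over `S = 2^t`
finishes (`volume_frequently_inhomApproxSet`). Only a pointwise bi-Lipschitz bound on the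
parameterisation is needed.

The lower bound holds pointwise (`one_div_le_inhomExponent`): if `x` is not very well approximable,
the associated unimodular lattice has no very short vector, hence a small covering radius, so every
`θ` is approximated. The converse is the case `θ = 0` together with Dirichlet's theorem. The dual
exponent adds no condition, by Khintchine transference (`dualExponent_le_of_simulExponent_le`). -/

/-! ### Geometry of numbers: Blichfeldt, Minkowski and a covering radius bound. -/

/-- Blichfeldt's principle: a set larger than a fundamental domain overlaps one of its lattice
translates. -/
theorem exists_int_sub_eq_of_one_lt_volume {ι : Type*} [Fintype ι] {S : Set (ι → ℝ)}
    (hS : MeasurableSet S) (h : 1 < volume S) :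
    ∃ z : ι → ℤ, z ≠ 0 ∧ ∃ a ∈ S, ∃ b ∈ S, ∀ i, a i - b i = z i := by
  classical
  have : Countable (Submodule.span ℤ (Set.range (Pi.basisFun ℝ ι))).toAddSubgroup :=
    inferInstanceAs (Countable (Submodule.span ℤ (Set.range (Pi.basisFun ℝ ι))))
  have fund := ZSpan.isAddFundamentalDomain' (Pi.basisFun ℝ ι) (volume : Measure (ι → ℝ))
  have hF : volume (ZSpan.fundamentalDomain (Pi.basisFun ℝ ι)) < volume S := by
    rw [ZSpan.fundamentalDomain_pi_basisFun]
    simpa [volume_pi, Measure.pi_pi] using h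
  obtain ⟨x, y, hxy, hd⟩ :=
    exists_pair_mem_lattice_not_disjoint_vadd fund hS.nullMeasurableSet hF
  obtain ⟨_, ⟨a, ha, rfl⟩, b, hb, hab⟩ := Set.not_disjoint_iff.mp hd
  have hint : ∀ v : (Submodule.span ℤ (Set.range (Pi.basisFun ℝ ι))).toAddSubgroup,
      ∃ z : ι → ℤ, ∀ i, (v : ι → ℝ) i = z i := by
    intro v
    have := ((Pi.basisFun ℝ ι).mem_span_iff_repr_mem ℤ (v : ι → ℝ)).1 v.2
    choose z hz using this
    exact ⟨z, fun i => by simpa using (hz i).symm⟩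
  obtain ⟨zx, hzx⟩ := hint x
  obtain ⟨zy, hzy⟩ := hint y
  have hab' : ∀ i, (zy i : ℝ) + b i = zx i + a i := by
    intro i
    have := congrFun hab i
    simpa [AddSubgroup.vadd_def, hzx, hzy] using this
  refine ⟨zy - zx, ?_, a, ha, b, hb, fun i => ?_⟩
  · intro h0
    apply hxy
    ext i
    rw [hzx, hzy, sub_eq_zero.1 h0]
  · have := hab' i
    simp only [Pi.sub_apply, Int.cast_sub]
    linarith

theorem exists_int_mulVec_sub_eq {ι : Type*} [Fintype ι] [DecidableEq ι] {A : Matrix ι ι ℝ}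
    (hA : A.det ≠ 0) {S : Set (ι → ℝ)} (hS : MeasurableSet S)
    (h : ENNReal.ofReal |A.det| < volume S) :
    ∃ z : ι → ℤ, z ≠ 0 ∧ ∃ a ∈ S, ∃ b ∈ S, a - b = A.mulVec fun i => (z i : ℝ) := by
  have hdet : LinearMap.det (Matrix.toLin' A) ≠ 0 := by rwa [LinearMap.det_toLin']
  have hvol : 1 < volume (Matrix.toLin' A ⁻¹' S) := by
    rw [Measure.addHaar_preimage_linearMap _ hdet, LinearMap.det_toLin', abs_inv]
    have hpos : 0 < |A.det| := abs_pos.2 hA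
    rw [ENNReal.ofReal_inv_of_pos hpos, mul_comm, ← div_eq_mul_inv]
    rw [ENNReal.lt_div_iff_mul_lt (Or.inl (by simpa using hA)) (Or.inl ENNReal.ofReal_ne_top)]
    simpa using h
  have hmeas : MeasurableSet (Matrix.toLin' A ⁻¹' S) :=
    (LinearMap.continuous_of_finiteDimensional _).measurable hS
  obtain ⟨z, hz, a, ha, b, hb, hab⟩ := exists_int_sub_eq_of_one_lt_volume hmeas hvol
  refine ⟨z, hz, _, ha, _, hb, ?_⟩
  rw [← map_sub, Matrix.toLin'_apply]
  congr 1
  ext i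
  exact hab i

/-- **Minkowski's linear forms theorem**, with strict inequalities. -/
theorem exists_int_abs_mulVec_lt {ι : Type*} [Fintype ι] [DecidableEq ι] {A : Matrix ι ι ℝ}
    (hA : A.det ≠ 0) {c : ι → ℝ} (hc : ∀ i, 0 < c i) (h : |A.det| < ∏ i, c i) :
    ∃ z : ι → ℤ, z ≠ 0 ∧ ∀ i, |A.mulVec (fun j => (z j : ℝ)) i| < c i := by
  have hS : MeasurableSet (Set.univ.pi fun i => Set.Ioo 0 (c i)) :=
    MeasurableSet.univ_pi fun i => measurableSet_Ioo
  have hvol : ENNReal.ofReal |A.det| < volume (Set.univ.pi fun i => Set.Ioo 0 (c i)) := by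
    rw [volume_pi, Measure.pi_pi]
    simp only [Real.volume_Ioo, sub_zero]
    rw [← ENNReal.ofReal_prod_of_nonneg fun i _ => (hc i).le]
    exact (ENNReal.ofReal_lt_ofReal_iff (Finset.prod_pos fun i _ => hc i)).2 h
  obtain ⟨z, hz, a, ha, b, hb, hab⟩ := exists_int_mulVec_sub_eq hA hS hvol
  refine ⟨z, hz, fun i => ?_⟩
  rw [← hab, Pi.sub_apply, abs_lt]
  have h1 := ha i trivial
  have h2 := hb i trivial
  constructor <;> linarith [h1.1, h1.2, h2.1, h2.2]

/-- If the nonzero values of a system of linear forms at integer points are bounded away from `0`,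
then every inhomogeneous system has an approximate integer solution. -/
theorem exists_int_norm_mulVec_sub_lt {ι : Type*} [Fintype ι] [DecidableEq ι] {A : Matrix ι ι ℝ}
    (hA : A.det ≠ 0) {r : ℝ} (hr : 0 < r)
    (hmin : ∀ z : ι → ℤ, z ≠ 0 → r ≤ ‖A.mulVec fun j => (z j : ℝ)‖) {N : ℕ}
    (hN : |A.det| < N * r ^ Fintype.card ι) (α : ι → ℝ) :
    ∃ z : ι → ℤ, ‖(A.mulVec fun j => (z j : ℝ)) - α‖ < N * r := by
  by_contra! hcon
  set Λ : Set (ι → ℝ) := Set.range fun z : ι → ℤ => A.mulVec fun j => (z j : ℝ) with hΛ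
  have h0Λ : (0 : ι → ℝ) ∈ Λ := ⟨0, by ext; simp [Matrix.mulVec, dotProduct]⟩
  have hα : N * r ≤ Metric.infDist α Λ := by
    refine (Metric.le_infDist ⟨0, h0Λ⟩).2 ?_
    rintro _ ⟨z, rfl⟩
    rw [dist_comm, dist_eq_norm]
    exact hcon z
  -- Along the segment from `0` to `α` the distance to the lattice takes every value `j * r` with `j
  -- < N`. The resulting `N` points are `r`-separated modulo the lattice, so the balls of radius `r
  -- / 2` about them have total volume `N * r ^ card ι`, too large to be disjoint modulo the
  -- lattice.
  have hcont : ContinuousOn (fun t : ℝ => Metric.infDist (t • α) Λ) (Set.Icc 0 1) :=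
    ((Metric.continuous_infDist_pt Λ).comp (by fun_prop)).continuousOn
  have hivt := intermediate_value_Icc (zero_le_one' ℝ) hcont
  simp only [zero_smul, one_smul, Metric.infDist_zero_of_mem h0Λ] at hivt
  have hex : ∀ j : Fin N, ∃ y : ι → ℝ, Metric.infDist y Λ = j * r := by
    intro j
    have hj : (j : ℝ) * r ∈ Set.Icc 0 (Metric.infDist α Λ) := by
      refine ⟨by positivity, le_trans ?_ hα⟩
      have : (j : ℝ) ≤ N := by exact_mod_cast j.2.le
      gcongr
    obtain ⟨t, -, ht⟩ := hivt hj
    exact ⟨_, ht⟩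
  choose y hy using hex
  have hinv : ∀ (v : ι → ℝ) (z : ι → ℤ),
      Metric.infDist (v + A.mulVec fun j => (z j : ℝ)) Λ ≤ Metric.infDist v Λ := by
    intro v z
    refine (Metric.le_infDist ⟨0, h0Λ⟩).2 ?_
    rintro _ ⟨z', rfl⟩
    have : (A.mulVec fun j => (((z' + z) j : ℤ) : ℝ)) =
        (A.mulVec fun j => (z' j : ℝ)) + A.mulVec fun j => (z j : ℝ) := by
      rw [← Matrix.mulVec_add]; congr 1; ext j; simp
    refine (Metric.infDist_le_dist_of_mem (Set.mem_range_self (z' + z))).trans (le_of_eq ?_)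
    rw [this, dist_add_right]
  have hsep : ∀ i j : Fin N, ∀ z : ι → ℤ, (i ≠ j ∨ z ≠ 0) →
      r ≤ dist (y i) (y j + A.mulVec fun k => (z k : ℝ)) := by
    intro i j z h
    by_cases hij : i = j
    · subst hij
      have hz : z ≠ 0 := by simpa using h
      simpa [dist_eq_norm] using hmin z hz
    · have h1 : Metric.infDist (y j + A.mulVec fun k => (z k : ℝ)) Λ = j * r := by
        refine le_antisymm ((hinv _ z).trans_eq (hy j)) ?_
        rw [← hy j]
        have h2 : (fun k => (((-z) k : ℤ) : ℝ)) = -fun k => (z k : ℝ) := by ext; simp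
        have h3 := hinv (y j + A.mulVec fun k => (z k : ℝ)) (-z)
        rwa [h2, Matrix.mulVec_neg, add_neg_cancel_right] at h3
      have h2 := (Metric.lipschitz_infDist_pt Λ).dist_le_mul (y i)
        (y j + A.mulVec fun k => (z k : ℝ))
      rw [hy i, h1, NNReal.coe_one, one_mul, Real.dist_eq, ← sub_mul, abs_mul, abs_of_pos hr] at h2
      refine le_trans ?_ h2
      have h3 : (1 : ℝ) ≤ |((i : ℕ) : ℝ) - ((j : ℕ) : ℝ)| := by
        have : ((i : ℕ) : ℤ) - ((j : ℕ) : ℤ) ≠ 0 := by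
          intro h; apply hij; ext; omega
        exact_mod_cast Int.one_le_abs this
      nlinarith
  have hvol : ENNReal.ofReal |A.det| < volume (⋃ j : Fin N, Metric.ball (y j) (r / 2)) := by
    rw [measure_iUnion]
    · simp only [Real.volume_pi_ball _ (half_pos hr), tsum_fintype, Finset.sum_const,
        Finset.card_univ, Fintype.card_fin, mul_div_cancel₀ r (two_ne_zero' ℝ), nsmul_eq_mul]
      rw [← ENNReal.ofReal_natCast, ← ENNReal.ofReal_mul (by positivity)]
      exact (ENNReal.ofReal_lt_ofReal_iff ((abs_nonneg _).trans_lt hN)).2 hN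
    · intro i j hij
      refine Metric.ball_disjoint_ball ?_
      have := hsep i j 0 (Or.inl hij)
      have h0 : (A.mulVec fun k => (((0 : ι → ℤ) k : ℤ) : ℝ)) = 0 := by
        ext; simp [Matrix.mulVec, dotProduct]
      rw [h0, add_zero] at this
      linarith
    · exact fun _ => Metric.isOpen_ball.measurableSet
  obtain ⟨z, hz, a, ha, b, hb, hab⟩ := exists_int_mulVec_sub_eq hA
    (MeasurableSet.iUnion fun _ => Metric.isOpen_ball.measurableSet) hvol
  obtain ⟨i, hi⟩ := Set.mem_iUnion.1 ha
  obtain ⟨j, hj⟩ := Set.mem_iUnion.1 hb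
  have h1 := hsep i j z (Or.inr hz)
  rw [← hab] at h1
  have h2 : dist (y i) (y j + (a - b)) ≤ dist a (y i) + dist b (y j) := by
    rw [dist_comm a, dist_eq_norm, dist_eq_norm, dist_eq_norm]
    refine le_trans (le_of_eq ?_) (norm_add_le _ _)
    congr 1
    abel
  rw [Metric.mem_ball] at hi hj
  linarith

/-! ### Growth of powers and reductions for exponents. -/

theorem eventually_const_mul_rpow_lt (C : ℝ) {a b : ℝ} (h : a < b) :
    ∀ᶠ X : ℝ in Filter.atTop, C * X ^ a < X ^ b := by
  filter_upwards [(tendsto_rpow_atTop (sub_pos.2 h)).eventually_gt_atTop C,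
    Filter.eventually_gt_atTop 0] with X hX h0
  calc C * X ^ a < X ^ (b - a) * X ^ a := by gcongr
    _ = X ^ b := by rw [← Real.rpow_add h0, sub_add_cancel]

theorem coe_le_of_forall_pos_lt {a : ℝ} (ha : 0 < a) {s : EReal}
    (h : ∀ w : ℝ, 0 < w → w < a → (w : EReal) ≤ s) : (a : EReal) ≤ s := by
  by_contra! hs
  obtain ⟨c, hc1, hc2⟩ := EReal.lt_iff_exists_real_btwn.1 hs
  have hca : c < a := by exact_mod_cast hc2
  have h1 := h (max c (a / 2)) (lt_max_of_lt_right (half_pos ha)) (max_lt hca (half_lt_self ha))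
  have h2 : (c : EReal) ≤ (max c (a / 2) : ℝ) := by exact_mod_cast le_max_left c (a / 2)
  exact absurd (h2.trans h1) (not_le.2 hc1)

/-- On a finite set `f` attains its minimum: a positive one contradicts `h`, and the exact solutions
are left to `h0`. -/
theorem infinite_of_forall_exists_lt {V : Type*} {S : Set V} (f : V → ℝ)
    (h : ∀ δ > 0, ∃ q ∈ S, f q < δ) (h0 : ∀ q ∈ S, f q ≤ 0 → S.Infinite) : S.Infinite := by
  by_contra hfin
  rw [Set.not_infinite] at hfin
  obtain ⟨q₁, hq₁, -⟩ := h 1 one_pos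
  obtain ⟨q₀, hq₀, hmin⟩ := Set.exists_min_image S f hfin ⟨q₁, hq₁⟩
  rcases le_or_gt (f q₀) 0 with hle | hlt
  · exact h0 q₀ hq₀ hle hfin
  · obtain ⟨q, hq, hlt'⟩ := h _ hlt
    exact absurd (hmin q hq) (not_le.2 hlt')

theorem abs_natAbs_mul_add_sign_mul (k p : ℤ) (t : ℝ) (hk : k ≠ 0) :
    |(k.natAbs : ℝ) * t - ((-(k.sign * p) : ℤ) : ℝ)| = |(k : ℝ) * t + p| := by
  have h1 : ((k.natAbs : ℕ) : ℝ) = (k.sign : ℝ) * (k : ℝ) := by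
    rw [← Int.cast_mul, Int.sign_mul_self_eq_natAbs]; simp
  rw [h1]
  push_cast
  rw [show (k.sign : ℝ) * k * t - -(k.sign * p) = k.sign * (k * t + p) by ring, abs_mul]
  have : |(k.sign : ℝ)| = 1 := by exact_mod_cast Int.abs_sign_of_ne_zero hk
  rw [this, one_mul]

theorem one_le_abs_intCast {k : ℤ} (hk : k ≠ 0) : (1 : ℝ) ≤ |(k : ℝ)| := by
  exact_mod_cast Int.one_le_abs hk

theorem eq_zero_of_abs_intCast_lt_one {k : ℤ} (hk : |(k : ℝ)| < 1) : k = 0 := by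
  by_contra h
  exact absurd (one_le_abs_intCast h) (not_le.2 hk)

/-! ### Homogeneous exponents and Dirichlet's theorem. -/

section

variable {n : ℕ}

theorem distNearestInt_le {y : Fin n → ℝ} {b : ℝ} (hb : 0 ≤ b) (p : Fin n → ℤ)
    (h : ∀ i, |y i - p i| ≤ b) : distNearestInt y ≤ b := by
  refine (pi_norm_le_iff_of_nonneg hb).2 fun i => ?_
  exact (round_le (y i) (p i)).trans (h i)

theorem abs_sub_round_le_distNearestInt (y : Fin n → ℝ) (i : Fin n) :
    |y i - round (y i)| ≤ distNearestInt y :=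
  norm_le_pi_norm (fun i => y i - round (y i)) i

/-- Testing only `w < a` absorbs `C`. The denominators `k` need not be shown to grow: errors tending
to `0` already force infinitely many of them, unless some error is exactly `0`. -/
theorem le_simulExponent {x : Fin n → ℝ} {a C : ℝ} (ha : 0 < a)
    (h : ∃ᶠ X : ℝ in atTop, ∃ k : ℤ, k ≠ 0 ∧ |(k : ℝ)| ≤ X ∧
      ∃ p : Fin n → ℤ, ∀ i, |(k : ℝ) * x i + p i| ≤ C * X ^ (-a)) :
    (a : EReal) ≤ simulExponent x := by
  refine coe_le_of_forall_pos_lt ha fun w hw hwa => le_sSup ⟨w, rfl, ?_⟩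
  refine infinite_of_forall_exists_lt (fun q : ℕ => distNearestInt ((q : ℝ) • x)) ?_ ?_
  · intro δ hδ
    have hsmall : ∀ᶠ X : ℝ in atTop, C * X ^ (-a) < δ := by
      have := (tendsto_rpow_neg_atTop ha).const_mul C
      rw [mul_zero] at this
      exact this.eventually_lt_const hδ
    obtain ⟨X, ⟨k, hk, hkX, p, hp⟩, hX, hXδ, hX0⟩ := (h.and_eventually
      ((eventually_const_mul_rpow_lt C (neg_lt_neg hwa)).and
        (hsmall.and (eventually_gt_atTop 0)))).exists
    have hb : ∀ i, |((k.natAbs : ℝ) • x) i - ((-(k.sign * p i) : ℤ) : ℝ)| ≤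
        max 0 (C * X ^ (-a)) := by
      intro i
      rw [Pi.smul_apply, smul_eq_mul, abs_natAbs_mul_add_sign_mul k (p i) (x i) hk]
      exact le_max_of_le_right (hp i)
    have hd := distNearestInt_le (le_max_left _ _) (fun i => -(k.sign * p i)) hb
    have hk1 : (0 : ℝ) < k.natAbs := by exact_mod_cast Int.natAbs_pos.2 hk
    refine ⟨k.natAbs, ⟨by simpa using hk, hd.trans_lt ?_⟩, hd.trans_lt (max_lt hδ hXδ)⟩
    have hle : X ^ (-w) ≤ (k.natAbs : ℝ) ^ (-w) := by
      refine Real.rpow_le_rpow_of_nonpos hk1 ?_ (by linarith)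
      rwa [Nat.cast_natAbs, Int.cast_abs]
    exact (max_lt (by positivity) hX).trans_le hle
  · rintro q ⟨hq0, -⟩ hq
    -- If `q • x` is an integer point, so is every multiple of it.
    refine Set.infinite_of_injective_forall_mem (f := fun k : ℕ => (k + 1) * q) ?_ ?_
    · intro k l hkl
      have := Nat.eq_of_mul_eq_mul_right (Nat.pos_of_ne_zero hq0) hkl
      omega
    · intro k
      have hne : (k + 1) * q ≠ 0 := by positivity
      refine ⟨hne, lt_of_le_of_lt ?_ (Real.rpow_pos_of_pos
        (by exact_mod_cast Nat.pos_of_ne_zero hne) _)⟩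
      refine distNearestInt_le le_rfl (fun i => (k + 1) * round (((q : ℝ) • x) i)) fun i => ?_
      have h1 : ((q : ℝ) • x) i - round (((q : ℝ) • x) i) = 0 :=
        abs_nonpos_iff.1 ((abs_sub_round_le_distNearestInt _ i).trans hq)
      have h2 : ((((k + 1) * q : ℕ) : ℝ) • x) i = (k + 1) * ((q : ℝ) • x) i := by
        simp; ring
      rw [h2]
      push_cast
      rw [← mul_sub, h1]
      simp

theorem eventually_not_approx_of_simulExponent_lt {x : Fin n → ℝ} {a : ℝ} (ha : 0 < a) (C : ℝ)
    (h : simulExponent x < a) :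
    ∀ᶠ X : ℝ in atTop, ∀ k : ℤ, k ≠ 0 → |(k : ℝ)| ≤ X →
      ∀ p : Fin n → ℤ, ¬∀ i, |(k : ℝ) * x i + p i| ≤ C * X ^ (-a) := by
  by_contra hcon
  refine absurd h (not_lt.2 (le_simulExponent (C := C) ha ?_))
  refine (not_eventually.1 hcon).mono fun X hX => ?_
  push Not at hX
  exact hX

/-- The matrix of the linear forms `a * z₀` and `b * (z₀ * x i + z i)`. -/
noncomputable def simulMatrix (x : Fin n → ℝ) (a b : ℝ) : Matrix (Unit ⊕ Fin n) (Unit ⊕ Fin n) ℝ :=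
  Matrix.fromBlocks (Matrix.of fun _ _ => a) 0 (Matrix.of fun i _ => b * x i) (b • 1)

theorem det_simulMatrix (x : Fin n → ℝ) (a b : ℝ) : (simulMatrix x a b).det = a * b ^ n := by
  simp [simulMatrix, Matrix.det_fromBlocks_zero₁₂]

theorem simulMatrix_mulVec_inl (x : Fin n → ℝ) (a b : ℝ) (z : Unit ⊕ Fin n → ℝ) :
    (simulMatrix x a b).mulVec z (Sum.inl ()) = a * z (Sum.inl ()) := by
  simp [simulMatrix, Matrix.mulVec, dotProduct]

theorem simulMatrix_mulVec_inr (x : Fin n → ℝ) (a b : ℝ) (z : Unit ⊕ Fin n → ℝ) (i : Fin n) :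
    (simulMatrix x a b).mulVec z (Sum.inr i) = b * (z (Sum.inl ()) * x i + z (Sum.inr i)) := by
  simp [simulMatrix, Matrix.mulVec, dotProduct, Matrix.one_apply]
  ring

theorem ne_zero_cases {z : Unit ⊕ Fin n → ℤ} (hz : z ≠ 0) :
    z (Sum.inl ()) ≠ 0 ∨ ∃ i, z (Sum.inr i) ≠ 0 := by
  by_contra! h
  apply hz
  ext (_ | i)
  · exact h.1
  · exact h.2 i

/-- **Dirichlet's theorem** for simultaneous approximation. -/
theorem one_div_le_simulExponent (hn : 1 ≤ n) (x : Fin n → ℝ) :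
    ((1 / (n : ℝ) : ℝ) : EReal) ≤ simulExponent x := by
  have hn0 : (0 : ℝ) < n := by exact_mod_cast hn
  have ha : 0 < 1 / (n : ℝ) := by positivity
  refine le_simulExponent (C := 2) ha (Eventually.frequently ?_)
  filter_upwards [eventually_const_mul_rpow_lt 2 (neg_lt_zero.2 ha), eventually_gt_atTop 0]
    with X hX hX0
  rw [Real.rpow_zero] at hX
  have hpos : 0 < 2 * X ^ (-(1 / (n : ℝ))) := by positivity
  -- The factor `2` gives the strict volume inequality `1 < 2 ^ n`.
  obtain ⟨z, hz, hzl⟩ := exists_int_abs_mulVec_lt (A := simulMatrix x 1 1)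
    (c := Sum.elim (fun _ => X) fun _ => 2 * X ^ (-(1 / (n : ℝ)))) (by simp [det_simulMatrix])
    (by rintro (_ | i) <;> assumption) (by
      have : (X ^ (-(1 / (n : ℝ)))) ^ n = X⁻¹ := by
        rw [← Real.rpow_natCast, ← Real.rpow_mul hX0.le, ← Real.rpow_neg_one]
        congr 1
        field_simp
      simp only [det_simulMatrix, Fintype.prod_sum_type, Sum.elim_inl, Sum.elim_inr,
        Finset.prod_const, Finset.card_univ, Fintype.card_fin, mul_pow, this, Fintype.card_unit,
        pow_one]
      have h2 : (1 : ℝ) < 2 ^ n := one_lt_pow₀ one_lt_two (by omega)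
      rw [mul_left_comm, mul_inv_cancel₀ hX0.ne']
      simpa using h2)
  have h0 := hzl (Sum.inl ())
  have h1 : ∀ i, |(z (Sum.inl ()) : ℝ) * x i + z (Sum.inr i)| < 2 * X ^ (-(1 / (n : ℝ))) := by
    intro i
    simpa [simulMatrix_mulVec_inr] using hzl (Sum.inr i)
  rw [simulMatrix_mulVec_inl, one_mul] at h0
  refine ⟨z (Sum.inl ()), fun h => ?_, h0.le, fun i => z (Sum.inr i), fun i => (h1 i).le⟩
  obtain h' | ⟨i, hi⟩ := ne_zero_cases hz
  · exact h' h
  · have := h1 i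
    rw [h, Int.cast_zero, zero_mul, zero_add] at this
    exact hi (eq_zero_of_abs_intCast_lt_one (this.trans hX))

theorem one_le_norm_of_ne_zero {q : Fin n → ℤ} (hq : q ≠ 0) : 1 ≤ ‖q‖ := by
  obtain ⟨i, hi⟩ := Function.ne_iff.1 hq
  refine le_trans ?_ (norm_le_pi_norm q i)
  rw [Int.norm_eq_abs]
  exact one_le_abs_intCast hi

/-- **Dirichlet's theorem** for a linear form. -/
theorem natCast_le_dualExponent (hn : 1 ≤ n) (x : Fin n → ℝ) :
    ((n : ℝ) : EReal) ≤ dualExponent x := by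
  have hn0 : (0 : ℝ) < n := by exact_mod_cast hn
  refine coe_le_of_forall_pos_lt hn0 fun w hw hwn => le_sSup ⟨w, rfl, ?_⟩
  refine infinite_of_forall_exists_lt (fun q : Fin n → ℤ =>
    |(∑ i, (q i : ℝ) * x i) - round (∑ i, (q i : ℝ) * x i)|) ?_ ?_
  · intro δ hδ
    have hsmall : ∀ᶠ X : ℝ in atTop, 2 * X ^ (-(n : ℝ)) < min δ 1 := by
      have := (tendsto_rpow_neg_atTop hn0).const_mul 2
      rw [mul_zero] at this
      exact this.eventually_lt_const (by positivity)
    obtain ⟨X, hX, hXδ, hX0⟩ := ((eventually_const_mul_rpow_lt 2 (neg_lt_neg hwn)).and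
        (hsmall.and (eventually_gt_atTop 0))).exists
    let A : Matrix (Unit ⊕ Fin n) (Unit ⊕ Fin n) ℝ :=
      Matrix.fromBlocks 1 (Matrix.of fun _ i => x i) 0 1
    have hdet : A.det = 1 := by simp [A]
    obtain ⟨z, hz, hzl⟩ := exists_int_abs_mulVec_lt (A := A)
      (c := Sum.elim (fun _ => 2 * X ^ (-(n : ℝ))) fun _ => X) (by simp [hdet])
      (by rintro (_ | i) <;> simp <;> positivity) (by
        simp only [hdet, Fintype.prod_sum_type, Sum.elim_inl, Sum.elim_inr, Finset.prod_const,
          Finset.card_univ, Fintype.card_fin, Fintype.card_unit, pow_one, abs_one]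
        rw [Real.rpow_neg hX0.le, Real.rpow_natCast, mul_assoc,
          inv_mul_cancel₀ (pow_pos hX0 n).ne']
        norm_num)
    have h0 : |(∑ i, (z (Sum.inr i) : ℝ) * x i) - ((-z (Sum.inl ()) : ℤ) : ℝ)| <
        2 * X ^ (-(n : ℝ)) := by
      have := hzl (Sum.inl ())
      simp only [A, Matrix.mulVec, dotProduct, Fintype.sum_sum_type, Sum.elim_inl] at this
      simpa [mul_comm, add_comm] using this
    have h1 : ∀ i, |(z (Sum.inr i) : ℝ)| < X := by
      intro i
      simpa [A, Matrix.mulVec, dotProduct, Matrix.one_apply] using hzl (Sum.inr i)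
    have hlt := (round_le (∑ i, (z (Sum.inr i) : ℝ) * x i) (-z (Sum.inl ()))).trans_lt h0
    have hne : (fun i => z (Sum.inr i)) ≠ 0 := by
      intro h
      have hzero : ∀ i, z (Sum.inr i) = 0 := fun i => congrFun h i
      obtain h' | ⟨i, hi⟩ := ne_zero_cases hz
      · simp only [hzero, Int.cast_zero, zero_mul, Finset.sum_const_zero, Int.cast_neg,
          sub_neg_eq_add, zero_add] at h0
        exact h' (eq_zero_of_abs_intCast_lt_one (h0.trans (hXδ.trans_le (min_le_right _ _))))
      · exact hi (hzero i)
    refine ⟨fun i => z (Sum.inr i), ⟨hne, hlt.trans ?_⟩,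
      hlt.trans (hXδ.trans_le (min_le_left _ _))⟩
    refine hX.trans_le (Real.rpow_le_rpow_of_nonpos
      (one_pos.trans_le (one_le_norm_of_ne_zero hne)) ?_ (by linarith))
    refine (pi_norm_le_iff_of_nonneg hX0.le).2 fun i => ?_
    rw [Int.norm_eq_abs]
    exact (h1 i).le
  · rintro q ⟨hq0, -⟩ hq
    refine Set.infinite_of_injective_forall_mem (f := fun k : ℕ => ((k : ℤ) + 1) • q) ?_ ?_
    · intro k l hkl
      have := smul_left_injective ℤ hq0 hkl
      omega
    · intro k
      have hne : ((k : ℤ) + 1) • q ≠ 0 := smul_ne_zero (by positivity) hq0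
      refine ⟨hne, lt_of_le_of_lt ?_ (Real.rpow_pos_of_pos
        (one_pos.trans_le (one_le_norm_of_ne_zero hne)) _)⟩
      have h1 := abs_nonpos_iff.1 hq
      have h2 : ∑ i, (((((k : ℤ) + 1) • q) i : ℤ) : ℝ) * x i = (k + 1) * ∑ i, (q i : ℝ) * x i := by
        rw [Finset.mul_sum]
        refine Finset.sum_congr rfl fun i _ => ?_
        simp
        ring
      rw [h2]
      refine (round_le _ ((k + 1) * round (∑ i, (q i : ℝ) * x i))).trans (le_of_eq ?_)
      push_cast
      rw [← mul_sub, h1]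
      simp

/-! ### Khintchine transference. -/

theorem finite_setOf_norm_le (B : ℝ) : {q : Fin n → ℤ | ‖q‖ ≤ B}.Finite := by
  refine (Set.finite_Icc (fun _ : Fin n => -⌈B⌉) (fun _ => ⌈B⌉)).subset fun q hq => ?_
  have h : ∀ i, |q i| ≤ ⌈B⌉ := by
    intro i
    have h1 : (|q i| : ℝ) ≤ B := by
      rw [← Int.norm_eq_abs]
      exact (norm_le_pi_norm q i).trans hq
    exact_mod_cast h1.trans (Int.le_ceil B)
  exact ⟨fun i => (abs_le.1 (h i)).1, fun i => (abs_le.1 (h i)).2⟩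

theorem exists_norm_eq_abs (hn : 1 ≤ n) (q : Fin n → ℤ) : ∃ j, ‖q‖ = |(q j : ℝ)| := by
  have : Nonempty (Fin n) := ⟨⟨0, hn⟩⟩
  obtain ⟨j, hj⟩ := Finite.exists_max fun i => |(q i : ℝ)|
  refine ⟨j, le_antisymm ((pi_norm_le_iff_of_nonneg (abs_nonneg _)).2 fun i => ?_) ?_⟩
  · rw [Int.norm_eq_abs]; exact hj i
  · rw [← Int.norm_eq_abs]; exact norm_le_pi_norm q j

/-- The effective form of Khintchine's transference: one good approximation to a linear form gives
one good simultaneous approximation. -/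
theorem exists_simul_approx_of_dual_approx {x : Fin n → ℝ} {q : Fin n → ℤ} {q₀ : ℤ} {j : Fin n}
    {Q η X δ : ℝ} (hQ : 0 < Q) (hq : ∀ i, |(q i : ℝ)| ≤ Q) (hj : |(q j : ℝ)| = Q)
    (hη : |(∑ i, (q i : ℝ) * x i) - q₀| ≤ η) (hδ : 0 < δ) (hX : 0 < X)
    (h : Q < X * δ ^ (n - 1)) (hsmall : η * X / Q + n * δ < 1) :
    ∃ k : ℤ, k ≠ 0 ∧ |(k : ℝ)| ≤ X ∧ ∃ p : Fin n → ℤ, ∀ i,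
      |(k : ℝ) * x i + p i| ≤ η * X / Q + n * δ := by
  classical
  set ξ : ℝ := (∑ i, (q i : ℝ) * x i) - q₀ with hξ
  -- Row `j` of the simultaneous system is replaced by the form `q · y - ξ * z₀`, which is integer
  -- valued at integer points. Minkowski with bound `1` on this row makes it vanish, and the
  -- relation is then solved for `y j`, where `|q j|` is maximal.
  let row : Unit ⊕ Fin n → ℝ := Sum.elim (fun _ => -ξ) fun i => (q i : ℝ)
  let R : Matrix (Unit ⊕ Fin n) (Unit ⊕ Fin n) ℝ := Matrix.updateRow 1 (Sum.inr j) row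
  have hdetR : R.det = q j := by
    have h1 := Matrix.cramer_transpose_apply (1 : Matrix (Unit ⊕ Fin n) (Unit ⊕ Fin n) ℝ) row
      (Sum.inr j)
    rw [Matrix.transpose_one, Matrix.cramer_one] at h1
    exact h1.symm
  have hdet : (R * simulMatrix x 1 1).det = q j := by
    rw [Matrix.det_mul, hdetR, det_simulMatrix]; simp
  have hqj : (q j : ℝ) ≠ 0 := by
    rw [← abs_pos, hj]; exact hQ
  let c : Unit ⊕ Fin n → ℝ := Sum.elim (fun _ => X) fun i => if i = j then 1 else δ
  have hcj : c (Sum.inr j) = 1 := if_pos rfl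
  have hcne : ∀ i, i ≠ j → c (Sum.inr i) = δ := fun i hi => if_neg hi
  have hcprod : ∏ i, c (Sum.inr i) = δ ^ (n - 1) := by
    rw [← Finset.mul_prod_erase _ _ (Finset.mem_univ j), hcj, one_mul,
      Finset.prod_congr rfl fun i hi => hcne i (Finset.ne_of_mem_erase hi), Finset.prod_const,
      Finset.card_erase_of_mem (Finset.mem_univ j), Finset.card_univ, Fintype.card_fin]
  obtain ⟨z, hz, hzl⟩ := exists_int_abs_mulVec_lt (A := R * simulMatrix x 1 1) (c := c)
    (by rwa [hdet]) (by
      rintro (_ | i)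
      · exact hX
      · by_cases hij : i = j
        · rw [hij, hcj]; exact one_pos
        · rw [hcne i hij]; exact hδ) (by
      rwa [hdet, hj, Fintype.prod_sum_type, hcprod, Fintype.prod_unique])
  set z₀ : ℤ := z (Sum.inl ()) with hz₀
  set y : Fin n → ℝ := fun i => (z₀ : ℝ) * x i + z (Sum.inr i) with hy
  have hvec : (simulMatrix x 1 1).mulVec (fun j => (z j : ℝ)) = Sum.elim (fun _ => (z₀ : ℝ)) y := by
    ext (_ | i)
    · rw [simulMatrix_mulVec_inl]; simp [hz₀]
    · rw [simulMatrix_mulVec_inr]; simp [hy, hz₀]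
  simp only [← Matrix.mulVec_mulVec, hvec] at hzl
  have hne : ∀ i, i ≠ Sum.inr j → ∀ v, R.mulVec v i = v i := by
    intro i hi v
    have : R i = (1 : Matrix (Unit ⊕ Fin n) (Unit ⊕ Fin n) ℝ) i := Matrix.updateRow_ne hi
    change R i ⬝ᵥ v = v i
    rw [this]
    exact congrFun (Matrix.one_mulVec v) i
  have h0 : |(z₀ : ℝ)| < X := by
    have := hzl (Sum.inl ())
    rwa [hne _ (by simp)] at this
  have h1 : ∀ i, i ≠ j → |y i| < δ := by
    intro i hi
    have := hzl (Sum.inr i)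
    rwa [hne _ (by simpa using hi), hcne i hi] at this
  have h2 : |-ξ * z₀ + ∑ i, (q i : ℝ) * y i| < 1 := by
    have h3 := hzl (Sum.inr j)
    have : R (Sum.inr j) = row := Matrix.updateRow_self
    simp only [Matrix.mulVec, this, hcj] at h3
    simpa only [row, dotProduct, Fintype.sum_sum_type, Sum.elim_inl, Sum.elim_inr,
      Finset.univ_unique, Finset.sum_singleton] using h3
  have h3 : -ξ * z₀ + ∑ i, (q i : ℝ) * y i =
      ((q₀ * z₀ + ∑ i, q i * z (Sum.inr i) : ℤ) : ℝ) := by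
    push_cast
    simp only [hξ, hy, mul_add, Finset.sum_add_distrib]
    have : ∑ i, (q i : ℝ) * (z₀ * x i) = (∑ i, (q i : ℝ) * x i) * z₀ := by
      rw [Finset.sum_mul]
      exact Finset.sum_congr rfl fun i _ => by ring
    rw [this]
    ring
  rw [h3] at h2
  rw [eq_zero_of_abs_intCast_lt_one h2, Int.cast_zero] at h3
  have hηX : 0 ≤ η * X / Q := by
    have := (abs_nonneg _).trans hη
    positivity
  have h4 : |y j| ≤ η * X / Q + n * δ := by
    have h5 : (q j : ℝ) * y j = ξ * z₀ - ∑ i ∈ Finset.univ.erase j, (q i : ℝ) * y i := by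
      rw [← Finset.add_sum_erase _ _ (Finset.mem_univ j)] at h3
      linarith
    have h6 : |∑ i ∈ Finset.univ.erase j, (q i : ℝ) * y i| ≤ n * (Q * δ) := by
      refine (Finset.abs_sum_le_sum_abs _ _).trans ?_
      calc ∑ i ∈ Finset.univ.erase j, |(q i : ℝ) * y i|
          ≤ ∑ i ∈ Finset.univ.erase j, Q * δ := by
            refine Finset.sum_le_sum fun i hi => ?_
            rw [abs_mul]
            exact mul_le_mul (hq i) (h1 i (Finset.ne_of_mem_erase hi)).le (abs_nonneg _) hQ.le
        _ ≤ ∑ i : Fin n, Q * δ :=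
            Finset.sum_le_sum_of_subset_of_nonneg (Finset.erase_subset _ _) fun _ _ _ => by
              positivity
        _ = n * (Q * δ) := by simp
    have h7 : Q * |y j| ≤ η * X + n * (Q * δ) := by
      rw [← hj, ← abs_mul, h5, hj]
      refine (abs_sub _ _).trans (add_le_add ?_ h6)
      rw [abs_mul]
      exact mul_le_mul hη h0.le (abs_nonneg _) ((abs_nonneg _).trans hη)
    rw [div_add' _ _ _ hQ.ne', le_div_iff₀ hQ]
    linarith
  have h5 : ∀ i, |y i| ≤ η * X / Q + n * δ := by
    intro i
    by_cases hi : i = j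
    · rw [hi]; exact h4
    · have hn : (1 : ℝ) ≤ n := by
        have : 1 ≤ n := Nat.one_le_iff_ne_zero.2 fun h => (h ▸ j).elim0
        exact_mod_cast this
      have := (h1 i hi).le
      nlinarith
  refine ⟨z₀, fun hzero => ?_, h0.le, fun i => z (Sum.inr i), h5⟩
  obtain h' | ⟨i, hi⟩ := ne_zero_cases hz
  · exact h' hzero
  · have := (h5 i).trans_lt hsmall
    simp only [hy, hzero, Int.cast_zero, zero_mul, zero_add] at this
    exact hi (eq_zero_of_abs_intCast_lt_one this)

/-- **Khintchine's transference principle**, in the extremal case. -/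
theorem dualExponent_le_of_simulExponent_le (hn : 1 ≤ n) {x : Fin n → ℝ}
    (h : simulExponent x ≤ ((1 / (n : ℝ) : ℝ) : EReal)) : dualExponent x ≤ ((n : ℝ) : EReal) := by
  have hn0 : (0 : ℝ) < n := by exact_mod_cast hn
  have hn1 : (1 : ℝ) ≤ n := by exact_mod_cast hn
  refine sSup_le ?_
  rintro _ ⟨w, rfl, hw⟩
  rw [EReal.coe_le_coe_iff]
  by_contra! hnw
  -- With `X ≈ Q ^ u` and `δ ≈ Q ^ (-v)`, both error terms have order `Q ^ (-v)` and `X * δ ^ (n -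
  -- 1)` has order `Q`. The resulting exponent `v / u` exceeds `1 / n` exactly when `v > 1`.
  set v : ℝ := w / n with hv
  have hv1 : 1 < v := (one_lt_div hn0).2 hnw
  have hvn : v * n = w := div_mul_cancel₀ _ hn0.ne'
  set u : ℝ := w + 1 - v with hu
  have hu0 : 0 < u := by nlinarith
  have hav : 1 / (n : ℝ) < v / u := by
    rw [div_lt_div_iff₀ hn0 hu0]
    nlinarith
  have ha0 : 0 < v / u := by positivity
  refine absurd (h.trans_lt (EReal.coe_lt_coe_iff.2 hav))
    (not_lt.2 (le_simulExponent (C := (2 + 2 * n) * 2 ^ (v / u)) ha0 ?_))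
  have hfreq : ∃ᶠ Q : ℝ in atTop, ∃ q : Fin n → ℤ, ‖q‖ = Q ∧
      |(∑ i, (q i : ℝ) * x i) - round (∑ i, (q i : ℝ) * x i)| < ‖q‖ ^ (-w) := by
    refine frequently_atTop.2 fun B => ?_
    obtain ⟨q, hq, hqB⟩ := (hw.sdiff (finite_setOf_norm_le B)).nonempty
    exact ⟨‖q‖, (not_le.1 hqB).le, q, rfl, hq.2⟩
  have htend : Tendsto (fun Q : ℝ => 2 * Q ^ u) atTop atTop :=
    (tendsto_rpow_atTop hu0).const_mul_atTop two_pos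
  refine htend.frequently ((hfreq.and_eventually ((eventually_const_mul_rpow_lt (2 + 2 * n)
    (show -v < 0 by linarith)).and (eventually_gt_atTop 0))).mono ?_)
  rintro Q ⟨⟨q, hqQ, hq⟩, hQs, hQ0⟩
  rw [Real.rpow_zero] at hQs
  obtain ⟨j, hj⟩ := exists_norm_eq_abs hn q
  have e1 : Q ^ (-w) * (2 * Q ^ u) / Q + n * (2 * Q ^ (-v)) = (2 + 2 * n) * Q ^ (-v) := by
    have : Q ^ (-w) * Q ^ u / Q = Q ^ (-v) := by
      rw [← Real.rpow_add hQ0, ← Real.rpow_sub_one hQ0.ne']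
      congr 1
      rw [hu]; ring
    rw [← this]
    ring
  have e2 : (2 + 2 * (n : ℝ)) * 2 ^ (v / u) * (2 * Q ^ u) ^ (-(v / u)) =
      (2 + 2 * n) * Q ^ (-v) := by
    rw [Real.mul_rpow two_pos.le (by positivity), ← Real.rpow_mul hQ0.le,
      mul_neg, mul_div_cancel₀ _ hu0.ne', mul_assoc, ← mul_assoc (2 ^ (v / u) : ℝ),
      ← Real.rpow_add two_pos, add_neg_cancel, Real.rpow_zero, one_mul]
  rw [hqQ] at hq
  have key := exists_simul_approx_of_dual_approx (x := x) (q := q) (η := Q ^ (-w))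
    (q₀ := round (∑ i, (q i : ℝ) * x i)) (j := j) (X := 2 * Q ^ u) (δ := 2 * Q ^ (-v)) hQ0
    (fun i => by rw [← hqQ, ← Int.norm_eq_abs]; exact norm_le_pi_norm q i) (by rw [← hj, hqQ])
    hq.le (by positivity) (by positivity) ?_ (by rwa [e1])
  · rw [e2]
    rwa [e1] at key
  · have h1 : Q ^ u * (Q ^ (-v)) ^ (n - 1) = Q := by
      rw [← Real.rpow_natCast, ← Real.rpow_mul hQ0.le, ← Real.rpow_add hQ0, Nat.cast_sub hn]
      conv_rhs => rw [← Real.rpow_one Q]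
      congr 1
      rw [hu]
      push_cast
      linarith
    rw [mul_pow, show (2 * Q ^ u * (2 ^ (n - 1) * (Q ^ (-v)) ^ (n - 1))) =
      2 * 2 ^ (n - 1) * (Q ^ u * (Q ^ (-v)) ^ (n - 1)) by ring, h1]
    have h2 : (1 : ℝ) ≤ 2 ^ (n - 1) := one_le_pow₀ one_le_two
    nlinarith

/-! ### The pointwise inhomogeneous lower bound. -/

/-- The lattice of `simulMatrix x X⁻¹ T` has determinant `1`, and its nonzero vectors have norm at
least `X ^ (-ε)`; hence every target lies within about `Y = X ^ (ε * (n + 1))` of it. -/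
theorem one_div_le_inhomExponent (hn : 1 ≤ n) {x : Fin n → ℝ}
    (h : simulExponent x ≤ ((1 / (n : ℝ) : ℝ) : EReal)) (θ : Fin n → ℝ) :
    ((1 / (n : ℝ) : ℝ) : EReal) ≤ inhomExponent x θ := by
  have hn0 : (0 : ℝ) < n := by exact_mod_cast hn
  have ha : 0 < 1 / (n : ℝ) := by positivity
  refine coe_le_of_forall_pos_lt ha fun w hw hwa => le_sSup ⟨w, hw.le, rfl, ?_⟩
  -- The factor `Y` is lost both in the error and in the size of the denominator, hence the `1 + w`.
  obtain ⟨ε, hε, hεw⟩ : ∃ ε > 0, ε * (n + 1) * (1 + w) < 1 / (n : ℝ) - w := by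
    refine ⟨(1 / (n : ℝ) - w) / (2 * ((n + 1) * (1 + w))), ?_, ?_⟩
    · have := sub_pos.2 hwa
      positivity
    · have := sub_pos.2 hwa
      rw [mul_assoc, div_mul_eq_mul_div, div_lt_iff₀ (by positivity)]
      have : 0 < (1 / (n : ℝ) - w) * ((n + 1) * (1 + w)) := by positivity
      linarith
  have hgood := eventually_not_approx_of_simulExponent_lt (a := 1 / (n : ℝ) + ε) (by positivity) 1
    (h.trans_lt (EReal.coe_lt_coe_iff.2 (by linarith)))
  suffices hsuff : ¬BddAbove {q : ℤ | q ≠ 0 ∧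
      distNearestInt ((q : ℝ) • x + θ) < |(q : ℝ)| ^ (-w)} from
    fun hfin => hsuff hfin.bddAbove
  rintro ⟨B, hB⟩
  obtain ⟨X, hX, hXw, hX1, hXB⟩ := (hgood.and ((eventually_const_mul_rpow_lt (2 * 6 ^ w)
    (show ε * (n + 1) - 1 / (n : ℝ) < -w * (1 + ε * (n + 1)) by nlinarith)).and
    ((eventually_ge_atTop 1).and (eventually_gt_atTop (B : ℝ))))).exists
  have hX0 : 0 < X := by linarith
  set Y : ℝ := X ^ (ε * (n + 1)) with hY
  have hY1 : 1 ≤ Y := Real.one_le_rpow hX1 (by positivity)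
  set T : ℝ := X ^ (1 / (n : ℝ)) with hT
  have hT1 : 1 ≤ T := Real.one_le_rpow hX1 ha.le
  have hT0 : 0 < T := by linarith
  have hr1 : X ^ (-ε) ≤ 1 := Real.rpow_le_one_of_one_le_of_nonpos hX1 (by linarith)
  have hdet : (simulMatrix x X⁻¹ T).det = 1 := by
    rw [det_simulMatrix, hT, ← Real.rpow_natCast, ← Real.rpow_mul hX0.le,
      one_div_mul_cancel hn0.ne', Real.rpow_one, inv_mul_cancel₀ hX0.ne']
  obtain ⟨z, hz⟩ := exists_int_norm_mulVec_sub_lt (A := simulMatrix x X⁻¹ T) (r := X ^ (-ε))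
    (N := ⌊Y⌋₊ + 1) (by simp [hdet]) (by positivity) (by
      intro z hz
      by_contra! hlt
      rw [pi_norm_lt_iff (by positivity)] at hlt
      have h0 := hlt (Sum.inl ())
      have h1 : ∀ i, T * |(z (Sum.inl ()) : ℝ) * x i + z (Sum.inr i)| < X ^ (-ε) := by
        intro i
        have := hlt (Sum.inr i)
        rwa [simulMatrix_mulVec_inr, Real.norm_eq_abs, abs_mul, abs_of_pos hT0] at this
      rw [simulMatrix_mulVec_inl, Real.norm_eq_abs, abs_mul, abs_of_pos (inv_pos.2 hX0),
        inv_mul_lt_iff₀ hX0] at h0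
      by_cases hz0 : z (Sum.inl ()) = 0
      · obtain h' | ⟨i, hi⟩ := ne_zero_cases hz
        · exact h' hz0
        · have := h1 i
          rw [hz0, Int.cast_zero, zero_mul, zero_add] at this
          have h2 := one_le_abs_intCast hi
          nlinarith
      · refine hX _ hz0 (by nlinarith) (fun i => z (Sum.inr i)) fun i => ?_
        have h2 : X ^ (-(1 / (n : ℝ) + ε)) = X ^ (-ε) / T := by
          rw [hT, ← Real.rpow_sub hX0]
          congr 1
          ring
        rw [one_mul, h2, le_div_iff₀ hT0, mul_comm]
        exact (h1 i).le) (by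
      rw [hdet, abs_one, ← Real.rpow_natCast, ← Real.rpow_mul hX0.le]
      have h1 : Y * X ^ (-ε * ((Fintype.card (Unit ⊕ Fin n) : ℕ) : ℝ)) = 1 := by
        rw [hY, ← Real.rpow_add hX0]
        convert Real.rpow_zero X using 2
        simp
        ring
      have h2 : Y < ((⌊Y⌋₊ + 1 : ℕ) : ℝ) := by
        push_cast
        exact Nat.lt_floor_add_one Y
      calc (1 : ℝ) = Y * X ^ (-ε * ((Fintype.card (Unit ⊕ Fin n) : ℕ) : ℝ)) := h1.symm
        _ < _ := by gcongr)
    -- Centring the first coordinate at `4 * Y`, beyond the error `2 * Y`, keeps `k` between `2 * Y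
    -- * X` and `6 * Y * X`: positive and unbounded as `X` grows.
    (Sum.elim (fun _ => 4 * Y) fun i => -(T * θ i))
  have hR : ((⌊Y⌋₊ + 1 : ℕ) : ℝ) * X ^ (-ε) ≤ 2 * Y := by
    have h1 : ((⌊Y⌋₊ + 1 : ℕ) : ℝ) ≤ 2 * Y := by
      push_cast
      linarith [Nat.floor_le (by linarith : 0 ≤ Y)]
    have h2 : (0 : ℝ) < X ^ (-ε) := by positivity
    nlinarith
  replace hz := hz.trans_le hR
  rw [pi_norm_lt_iff (by positivity)] at hz
  have h0 := hz (Sum.inl ())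
  rw [Pi.sub_apply, simulMatrix_mulVec_inl, Sum.elim_inl, Real.norm_eq_abs, abs_lt] at h0
  set k : ℤ := z (Sum.inl ()) with hk
  have hkl : 2 * Y * X < k := by
    have : 2 * Y < X⁻¹ * k := by linarith [h0.1]
    rwa [inv_mul_eq_div, lt_div_iff₀ hX0] at this
  have hku : (k : ℝ) < 6 * (X * Y) := by
    have : X⁻¹ * k < 6 * Y := by linarith [h0.2]
    rw [inv_mul_eq_div, div_lt_iff₀ hX0] at this
    linarith
  have hXk : X < k := by nlinarith
  have hk0 : (0 : ℝ) < k := by linarith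
  have hmem : k ∈ {q : ℤ | q ≠ 0 ∧ distNearestInt ((q : ℝ) • x + θ) < |(q : ℝ)| ^ (-w)} := by
    refine ⟨by exact_mod_cast hk0.ne', ?_⟩
    have hd : distNearestInt ((k : ℝ) • x + θ) ≤ 2 * Y / T := by
      refine distNearestInt_le (by positivity) (fun i => -z (Sum.inr i)) fun i => ?_
      have h1 := hz (Sum.inr i)
      rw [Pi.sub_apply, simulMatrix_mulVec_inr, Sum.elim_inr, Real.norm_eq_abs] at h1
      rw [le_div_iff₀ hT0]
      refine le_trans (le_of_eq ?_) h1.le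
      conv_lhs => rw [← abs_of_pos hT0, ← abs_mul]
      congr 1
      simp [← hk]
      ring
    refine hd.trans_lt ?_
    rw [abs_of_pos hk0]
    have h1 : (6 * (X * Y)) ^ (-w) ≤ (k : ℝ) ^ (-w) :=
      Real.rpow_le_rpow_of_nonpos hk0 hku.le (by linarith)
    refine lt_of_lt_of_le ?_ h1
    have h2 : X * Y = X ^ (1 + ε * (n + 1)) := by
      rw [hY, Real.rpow_add hX0, Real.rpow_one]
    have h3 : Y / T = X ^ (ε * (n + 1) - 1 / (n : ℝ)) := by
      rw [hY, hT, Real.rpow_sub hX0]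
    rw [mul_div_assoc, h3, Real.mul_rpow (by norm_num) (by positivity), h2,
      ← Real.rpow_mul hX0.le, mul_comm (1 + ε * (n + 1) : ℝ), Real.rpow_neg (by norm_num),
      ← div_eq_inv_mul, lt_div_iff₀ (by positivity)]
    linarith
  have := hB hmem
  have : (k : ℝ) ≤ B := by exact_mod_cast this
  linarith

end

/-! ### The almost everywhere upper bound: clustering and Borel–Cantelli. -/

/-- A bounded set in which any two points at distance less than `b` are at distance at most `a` has
measure of order at most `(a / b) ^ d`. -/
theorem volume_le_of_dist_gap {d : ℕ} {G : Set (Fin d → ℝ)} {c : Fin d → ℝ} {a b ρ : ℝ}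
    (ha : 0 ≤ a) (hb : 0 < b) (hG : G ⊆ Metric.ball c ρ)
    (h : ∀ u ∈ G, ∀ u' ∈ G, dist u u' < b → dist u u' ≤ a) :
    volume G ≤ ENNReal.ofReal ((2 * a / b) ^ d) * volume (Metric.ball c (ρ + b)) := by
  -- For a maximal `b`-separated subset, the balls of radius `a` cover `G` while those of radius `b
  -- / 2` are disjoint.
  obtain ⟨P, hP⟩ := zorn_subset {P : Set (Fin d → ℝ) | P ⊆ G ∧ P.Pairwise fun u u' => b ≤ dist u u'}
    (fun C hC hchain => ⟨⋃₀ C, ⟨Set.sUnion_subset fun s hs => (hC hs).1,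
      (Set.pairwise_sUnion hchain.directedOn).2 fun s hs => (hC hs).2⟩,
      fun s hs => Set.subset_sUnion_of_mem hs⟩)
  have hdisj : P.PairwiseDisjoint fun p => Metric.ball p (b / 2) := by
    intro p hp p' hp' hne
    refine Metric.ball_disjoint_ball ?_
    linarith [hP.prop.2 hp hp' hne]
  have hcount : P.Countable := hdisj.countable_of_isOpen (fun _ _ => Metric.isOpen_ball)
    fun p _ => Metric.nonempty_ball.2 (half_pos hb)
  have hcover : G ⊆ ⋃ p ∈ P, Metric.closedBall p a := by
    intro g hg
    simp only [Set.mem_iUnion, Metric.mem_closedBall]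
    by_contra! hcon
    have hfar : ∀ p ∈ P, b ≤ dist g p := fun p hp => by
      by_contra! hlt
      exact absurd (h g hg p (hP.prop.1 hp) hlt) (not_le.2 (hcon p hp))
    have hins : insert g P ∈
        {P : Set (Fin d → ℝ) | P ⊆ G ∧ P.Pairwise fun u u' => b ≤ dist u u'} := by
      refine ⟨Set.insert_subset hg hP.prop.1, hP.prop.2.insert fun p hp _ => ?_⟩
      exact ⟨hfar p hp, by rw [dist_comm]; exact hfar p hp⟩
    have hgP : g ∈ P := hP.le_of_ge hins (Set.subset_insert g P) (Set.mem_insert g P)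
    have := hcon g hgP
    rw [dist_self] at this
    linarith
  calc volume G ≤ volume (⋃ p ∈ P, Metric.closedBall p a) := measure_mono hcover
    _ ≤ ∑' p : P, volume (Metric.closedBall (p : Fin d → ℝ) a) := measure_biUnion_le _ hcount _
    _ = ∑' p : P, ENNReal.ofReal ((2 * a / b) ^ d) *
          volume (Metric.ball (p : Fin d → ℝ) (b / 2)) := by
        refine tsum_congr fun p => ?_
        rw [Real.volume_pi_closedBall _ ha, Real.volume_pi_ball _ (half_pos hb),
          ← ENNReal.ofReal_mul (by positivity), Fintype.card_fin, ← mul_pow]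
        congr 2
        field_simp
    _ = ENNReal.ofReal ((2 * a / b) ^ d) * volume (⋃ p ∈ P, Metric.ball p (b / 2)) := by
        rw [ENNReal.tsum_mul_left, measure_biUnion hcount hdisj fun _ _ =>
          Metric.isOpen_ball.measurableSet]
    _ ≤ _ := by
        gcongr
        refine Set.iUnion₂_subset fun p hp => Metric.ball_subset_ball' ?_
        have := Metric.mem_ball.1 (hG (hP.prop.1 hp))
        linarith

/-- No nonzero multiple `k • x` with `|k| ≤ 4 * S` is within `4 * S ^ (-v)` of an integer point. -/
def NotApproximable {n : ℕ} (x : Fin n → ℝ) (v S : ℝ) : Prop :=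
  ∀ k : ℤ, k ≠ 0 → |(k : ℝ)| ≤ 4 * S → ∀ p : Fin n → ℤ,
    ¬∀ i, |(k : ℝ) * x i + p i| ≤ 4 * S ^ (-v)

/-- Subtracting the two approximations cancels `θ` and leaves an error of at most `2 * S ^ (-w) +
|q'| * dist x x' ≤ 4 * S ^ (-v)` for `(q - q') • x`. This forces `q = q'`, then equal numerators as
the error is below `1`; dividing by `q` gives the bound. -/
theorem dist_le_of_notApproximable {n : ℕ} {x x' θ : Fin n → ℝ} {v w S : ℝ} {q q' : ℤ}
    (hvw : v ≤ w) (hS : 1 ≤ S) (hSv : 4 * S ^ (-v) < 1) (hx : NotApproximable x v S)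
    (hq : S ≤ |(q : ℝ)|) (hqS : |(q : ℝ)| < 2 * S) (hqS' : |(q' : ℝ)| < 2 * S)
    (hqx : distNearestInt ((q : ℝ) • x + θ) ≤ S ^ (-w))
    (hqx' : distNearestInt ((q' : ℝ) • x' + θ) ≤ S ^ (-w)) (hd : dist x x' ≤ S ^ (-v) / S) :
    dist x x' ≤ 2 * (S ^ (-w) / S) := by
  have hS0 : 0 < S := by linarith
  have hwv : S ^ (-w) ≤ S ^ (-v) := Real.rpow_le_rpow_of_exponent_le hS (by linarith)
  set p : Fin n → ℤ := fun i => round (((q : ℝ) • x + θ) i)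
  set p' : Fin n → ℤ := fun i => round (((q' : ℝ) • x' + θ) i)
  have hp : ∀ i, |q * x i + θ i - p i| ≤ S ^ (-w) := fun i =>
    (abs_sub_round_le_distNearestInt _ i).trans hqx
  have hp' : ∀ i, |q' * x' i + θ i - p' i| ≤ S ^ (-w) := fun i =>
    (abs_sub_round_le_distNearestInt _ i).trans hqx'
  have hdi : ∀ i, |q' * (x i - x' i)| ≤ 2 * S ^ (-v) := by
    intro i
    have h1 : |x i - x' i| ≤ S ^ (-v) / S := (dist_le_pi_dist x x' i).trans hd
    rw [abs_mul]
    calc |(q' : ℝ)| * |x i - x' i| ≤ 2 * S * (S ^ (-v) / S) := by gcongr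
      _ = 2 * S ^ (-v) := by field_simp
  have key : ∀ i, |((q - q' : ℤ) : ℝ) * x i + ((p' - p : Fin n → ℤ) i : ℤ)| ≤ 4 * S ^ (-v) := by
    intro i
    have h1 := abs_le.1 (hp i)
    have h2 := abs_le.1 (hp' i)
    have h3 := abs_le.1 (hdi i)
    rw [abs_le]
    push_cast [Pi.sub_apply]
    constructor <;> linarith [h1.1, h1.2, h2.1, h2.2, h3.1, h3.2]
  have hqq : q = q' := by
    by_contra hne
    refine hx (q - q') (sub_ne_zero.2 hne) ?_ (p' - p) key
    push_cast
    exact (abs_sub _ _).trans (by linarith)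
  subst hqq
  have hpp : ∀ i, p' i = p i := by
    intro i
    have h1 := (key i).trans_lt hSv
    rw [sub_self, Int.cast_zero, zero_mul, zero_add] at h1
    exact sub_eq_zero.1 (eq_zero_of_abs_intCast_lt_one h1)
  refine (dist_pi_le_iff (by positivity)).2 fun i => ?_
  have h1 := abs_le.1 (hp i)
  have h2 := abs_le.1 (hp' i)
  rw [hpp] at h2
  have h3 : |(q : ℝ)| * |x i - x' i| ≤ 2 * S ^ (-w) := by
    rw [← abs_mul, abs_le]
    constructor <;> linarith [h1.1, h1.2, h2.1, h2.2]
  rw [Real.dist_eq, ← mul_div_assoc, le_div_iff₀ hS0]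
  nlinarith [abs_nonneg (x i - x' i)]

theorem eventually_notApproximable {n : ℕ} {x : Fin n → ℝ} {v : ℝ} (hv : 0 < v)
    (h : simulExponent x < v) : ∀ᶠ t : ℕ in atTop, NotApproximable x v (2 ^ t) := by
  have htend : Tendsto (fun t : ℕ => 4 * (2 : ℝ) ^ t) atTop atTop :=
    (tendsto_pow_atTop_atTop_of_one_lt one_lt_two).const_mul_atTop (by norm_num)
  -- The constant comes from `4 * S ^ (-v) = 4 * 4 ^ v * (4 * S) ^ (-v)`.
  filter_upwards [htend.eventually
    (eventually_not_approx_of_simulExponent_lt hv (4 * 4 ^ v) h)] with t ht k hk hkt p hp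
  refine ht k hk hkt p fun i => (hp i).trans (le_of_eq ?_)
  rw [Real.mul_rpow (by norm_num) (by positivity), Real.rpow_neg (by norm_num : (0 : ℝ) ≤ 4)]
  field_simp

/-- `u` has the bi-Lipschitz property with constant `m + 1` on the scale `1 / (m + 1)`. -/
def BilipschitzAt {n d : ℕ} (φ : (Fin d → ℝ) → (Fin n → ℝ)) (m : ℕ) (u : Fin d → ℝ) : Prop :=
  ∀ v, dist v u < 1 / (m + 1 : ℝ) →
    dist v u ≤ (m + 1) * dist (φ v) (φ u) ∧ dist (φ v) (φ u) ≤ (m + 1) * dist v u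

/-- An injective linear map in finite dimension is bounded below, so the increment of `φ` is
comparable to that of its argument. A single integer bounds the radius and both constants, giving a
countable decomposition. -/
theorem exists_bilipschitzAt {n d : ℕ} {φ : (Fin d → ℝ) → (Fin n → ℝ)} {u : Fin d → ℝ}
    (h : DifferentiableAt ℝ φ u) (hinj : Function.Injective (fderiv ℝ φ u)) :
    ∃ m, BilipschitzAt φ m u := by
  obtain ⟨K, -, hK⟩ := (LinearMap.injective_iff_antilipschitz (fderiv ℝ φ u).toLinearMap).1 hinj
  have hO : (fun v => v - u) =O[𝓝 u] fun v => fderiv ℝ φ u (v - u) :=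
    Asymptotics.isBigO_iff.2 ⟨K, Eventually.of_forall fun v => by
      simpa using hK.le_mul_dist (v - u) 0⟩
  have hequiv : (fun v => φ v - φ u) ~[𝓝 u] fun v => fderiv ℝ φ u (v - u) :=
    h.hasFDerivAt.isLittleO.trans_isBigO hO
  obtain ⟨C₁, h₁⟩ := (hO.trans hequiv.isBigO_symm).bound
  obtain ⟨C₂, h₂⟩ := h.hasFDerivAt.isBigO_sub.bound
  obtain ⟨ε, hε, hball⟩ := Metric.eventually_nhds_iff.1 (h₁.and h₂)
  obtain ⟨m, hm⟩ := exists_nat_ge (max (1 / ε) (max C₁ C₂))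
  have hm1 : 1 / ε < (m : ℝ) + 1 := ((le_max_left _ _).trans hm).trans_lt (lt_add_one _)
  have hm2 : C₁ ≤ m + 1 := by
    linarith [(le_max_left C₁ C₂).trans ((le_max_right _ _).trans hm)]
  have hm3 : C₂ ≤ m + 1 := by
    linarith [(le_max_right C₁ C₂).trans ((le_max_right _ _).trans hm)]
  refine ⟨m, fun v hv => ?_⟩
  have hvε : dist v u < ε := hv.trans (by
    rw [div_lt_iff₀ (by positivity)]
    rwa [div_lt_iff₀ hε, mul_comm] at hm1)
  obtain ⟨b1, b2⟩ := hball hvε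
  rw [dist_eq_norm, dist_eq_norm]
  exact ⟨b1.trans (by gcongr), b2.trans (by gcongr)⟩

section

variable {n d : ℕ} (φ : (Fin d → ℝ) → (Fin n → ℝ)) (θ : Fin n → ℝ)

/-- The parameters near `c`, of bi-Lipschitz constant `m + 1`, whose image is inhomogeneously
approximable with a denominator of size `2 ^ t`, but not homogeneously. -/
def inhomApproxSet (m : ℕ) (c : Fin d → ℝ) (v w : ℝ) (t : ℕ) : Set (Fin d → ℝ) :=
  {u | u ∈ Metric.ball c (1 / (2 * (m + 1) : ℝ)) ∧ BilipschitzAt φ m u ∧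
    4 * ((2 : ℝ) ^ t) ^ (-v) < 1 ∧ NotApproximable (φ u) v (2 ^ t) ∧
    ∃ q : ℤ, (2 : ℝ) ^ t ≤ |(q : ℝ)| ∧ |(q : ℝ)| < 2 * 2 ^ t ∧
      distNearestInt ((q : ℝ) • φ u + θ) < |(q : ℝ)| ^ (-w)}

/-- The gap `S ^ (-v) / S / M` against the cluster size `2 * M * S ^ (-w) / S` gives the ratio `4 *
M ^ 2 * S ^ (v - w)`. The enlarged ball has radius at most `2`, hence `4 ^ d`; since `d ≥ 1`, one
factor `S ^ (v - w)` suffices for a geometric series. -/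
theorem volume_inhomApproxSet_le (hd : 1 ≤ d) (m : ℕ) (c : Fin d → ℝ) {v w : ℝ} (hv : 0 < v)
    (hvw : v < w) (t : ℕ) :
    volume (inhomApproxSet φ θ m c v w t) ≤
      ENNReal.ofReal ((4 * (m + 1) ^ 2) ^ d * 4 ^ d * ((2 : ℝ) ^ (v - w)) ^ t) := by
  set S : ℝ := 2 ^ t with hS
  have hS1 : 1 ≤ S := one_le_pow₀ one_le_two
  have hS0 : 0 < S := by linarith
  set M : ℝ := m + 1 with hM
  have hM1 : 1 ≤ M := by simp [hM]
  have hM0 : 0 < M := by linarith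
  have hSv1 : S ^ (-v) ≤ 1 := Real.rpow_le_one_of_one_le_of_nonpos hS1 (by linarith)
  have hgap : ∀ u ∈ inhomApproxSet φ θ m c v w t, ∀ u' ∈ inhomApproxSet φ θ m c v w t,
      dist u u' < S ^ (-v) / S / M → dist u u' ≤ M * (2 * (S ^ (-w) / S)) := by
    rintro u ⟨huc, -, hSv, hna, q, hq, hq2, hqu⟩ u' ⟨huc', hbi, -, -, q', hq', hq2', hqu'⟩ hlt
    have hnear : dist u u' < 1 / M := by
      have h1 := dist_triangle_right u u' c
      rw [Metric.mem_ball] at huc huc'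
      have h2 : 1 / M = 1 / (2 * M) + 1 / (2 * M) := by field_simp; norm_num
      rw [h2]
      exact h1.trans_lt (add_lt_add huc huc')
    obtain ⟨b1, b2⟩ := hbi u hnear
    have hle : ∀ {k : ℤ}, S ≤ |(k : ℝ)| → |(k : ℝ)| ^ (-w) ≤ S ^ (-w) := fun hk =>
      Real.rpow_le_rpow_of_nonpos hS0 hk (by linarith)
    refine b1.trans (mul_le_mul_of_nonneg_left ?_ hM0.le)
    refine dist_le_of_notApproximable (θ := θ) hvw.le hS1 hSv hna hq hq2 hq2'
      (hqu.le.trans (hle hq)) (hqu'.le.trans (hle hq')) (b2.trans ?_)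
    rw [lt_div_iff₀ hM0] at hlt
    linarith
  have hb1 : S ^ (-v) / S / M ≤ 1 :=
    div_le_one_of_le₀ ((div_le_one_of_le₀ (hSv1.trans hS1) hS0.le).trans hM1) hM0.le
  refine (volume_le_of_dist_gap (c := c) (by positivity) (by positivity)
    (fun u hu => hu.1) hgap).trans ?_
  have h2M : 1 / (2 * M) ≤ 1 := div_le_one_of_le₀ (by linarith) (by positivity)
  rw [Real.volume_pi_ball _ (by positivity), ← ENNReal.ofReal_mul (by positivity),
    Fintype.card_fin]
  refine ENNReal.ofReal_le_ofReal ?_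
  have e1 : 2 * (M * (2 * (S ^ (-w) / S))) / (S ^ (-v) / S / M) = 4 * M ^ 2 * S ^ (v - w) := by
    rw [show v - w = -w - -v by ring, Real.rpow_sub hS0 (-w) (-v)]
    field_simp
    norm_num
  have e2 : S ^ (v - w) = ((2 : ℝ) ^ (v - w)) ^ t := by
    rw [hS, ← Real.rpow_natCast, ← Real.rpow_natCast, ← Real.rpow_mul two_pos.le,
      ← Real.rpow_mul two_pos.le, mul_comm]
  have e3 : S ^ (v - w) ≤ 1 := Real.rpow_le_one_of_one_le_of_nonpos hS1 (by linarith)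
  rw [e1, ← e2, mul_pow, mul_right_comm]
  gcongr
  · linarith
  · exact pow_le_of_le_one (by positivity) e3 (by omega)

theorem volume_frequently_inhomApproxSet (hd : 1 ≤ d) (m : ℕ) (c : Fin d → ℝ) {v w : ℝ}
    (hv : 0 < v) (hvw : v < w) :
    volume {u | ∃ᶠ t in atTop, u ∈ inhomApproxSet φ θ m c v w t} = 0 := by
  refine measure_setOfPred_frequently_eq_zero (p := fun t u => u ∈ inhomApproxSet φ θ m c v w t) ?_
  refine ne_top_of_le_ne_top (Summable.tsum_ofReal_ne_top ?_)
    (ENNReal.tsum_le_tsum fun t => volume_inhomApproxSet_le φ θ hd m c hv hvw t)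
  exact (summable_geometric_of_lt_one (by positivity)
    (Real.rpow_lt_one_of_one_lt_of_neg one_lt_two (by linarith))).mul_left _

variable {φ θ}

theorem frequently_mem_inhomApproxSet {m : ℕ} {c u : Fin d → ℝ} {v w : ℝ} (hv : 0 < v)
    (hsim : simulExponent (φ u) < v) (hbi : BilipschitzAt φ m u)
    (hc : u ∈ Metric.ball c (1 / (2 * (m + 1) : ℝ)))
    (hinf : {q : ℤ | q ≠ 0 ∧ distNearestInt ((q : ℝ) • φ u + θ) < |(q : ℝ)| ^ (-w)}.Infinite) :
    ∃ᶠ t in atTop, u ∈ inhomApproxSet φ θ m c v w t := by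
  have hfreq : ∃ᶠ t : ℕ in atTop, ∃ q : ℤ, (2 : ℝ) ^ t ≤ |(q : ℝ)| ∧ |(q : ℝ)| < 2 * 2 ^ t ∧
      distNearestInt ((q : ℝ) • φ u + θ) < |(q : ℝ)| ^ (-w) := by
    refine frequently_atTop.2 fun T => ?_
    obtain ⟨q, ⟨hq0, hq⟩, hqT⟩ := (hinf.sdiff (Set.finite_Icc (-2 ^ T : ℤ) (2 ^ T))).nonempty
    have hT : 2 ^ T ≤ q.natAbs := by
      by_contra! hlt
      apply hqT
      have : ((q.natAbs : ℕ) : ℤ) < 2 ^ T := by exact_mod_cast hlt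
      rw [Int.natCast_natAbs] at this
      exact ⟨(abs_le.1 this.le).1, (abs_le.1 this.le).2⟩
    have hne : q.natAbs ≠ 0 := by simpa using hq0
    have habs : |(q : ℝ)| = (q.natAbs : ℝ) := by rw [Nat.cast_natAbs, Int.cast_abs]
    refine ⟨Nat.log 2 q.natAbs, (Nat.le_log_iff_pow_le (by norm_num) hne).2 hT, q, ?_, ?_, hq⟩
    · rw [habs]
      exact_mod_cast Nat.pow_log_le_self 2 hne
    · rw [habs, ← pow_succ']
      exact_mod_cast Nat.lt_pow_succ_log_self (by norm_num) q.natAbs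
  have hsmall : ∀ᶠ t : ℕ in atTop, 4 * ((2 : ℝ) ^ t) ^ (-v) < 1 := by
    have := eventually_const_mul_rpow_lt 4 (neg_lt_zero.2 hv)
    filter_upwards [(tendsto_pow_atTop_atTop_of_one_lt (one_lt_two (α := ℝ))).eventually this]
      with t ht
    rwa [Real.rpow_zero] at ht
  refine (hfreq.and_eventually (hsmall.and (eventually_notApproximable hv hsim))).mono ?_
  rintro t ⟨hq, hs, hna⟩
  exact ⟨hc, hbi, hs, hna, hq⟩

/-- The bi-Lipschitz constant varies with the point, so nullity is proved for each `m`, locally on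
balls of radius `1 / (2 * (m + 1))`, and the countable union is taken. -/
theorem ae_not_infinite_of_ae_simulExponent_lt (hd : 1 ≤ d) {U : Set (Fin d → ℝ)} (hU : IsOpen U)
    (hdiff : ∀ u ∈ U, DifferentiableAt ℝ φ u)
    (hinj : ∀ u ∈ U, Function.Injective (fderiv ℝ φ u)) {v w : ℝ} (hv : 0 < v) (hvw : v < w)
    (h : ∀ᵐ u ∂(volume.restrict U), simulExponent (φ u) < v) :
    ∀ᵐ u ∂(volume.restrict U),
      ¬{q : ℤ | q ≠ 0 ∧ distNearestInt ((q : ℝ) • φ u + θ) < |(q : ℝ)| ^ (-w)}.Infinite := by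
  have hnull : ∀ m : ℕ, volume {u | BilipschitzAt φ m u ∧ simulExponent (φ u) < v ∧
      {q : ℤ | q ≠ 0 ∧ distNearestInt ((q : ℝ) • φ u + θ) < |(q : ℝ)| ^ (-w)}.Infinite} = 0 := by
    intro m
    refine measure_null_of_locally_null _ fun c _ => ?_
    refine ⟨_, inter_mem_nhdsWithin _ (Metric.ball_mem_nhds c
        (show (0 : ℝ) < 1 / (2 * (m + 1) : ℝ) by positivity)), ?_⟩
    refine measure_mono_null ?_ (volume_frequently_inhomApproxSet φ θ hd m c hv hvw)
    rintro u ⟨⟨hbi, hsim, hinf⟩, hc⟩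
    exact frequently_mem_inhomApproxSet hv hsim hbi hc hinf
  have hall := ae_restrict_of_ae (s := U) (ae_all_iff.2 fun m =>
    measure_eq_zero_iff_ae_notMem.1 (hnull m))
  filter_upwards [h, hall, ae_restrict_mem hU.measurableSet] with u hsim hu huU hinf
  obtain ⟨m, hm⟩ := exists_bilipschitzAt (hdiff u huU) (hinj u huU)
  exact hu m ⟨hm, hsim, hinf⟩

theorem inhomExponent_le_of_forall_not_infinite {x : Fin n → ℝ} {a : ℝ} (h : ∀ k : ℕ,
    ¬{q : ℤ | q ≠ 0 ∧ distNearestInt ((q : ℝ) • x + θ) <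
      |(q : ℝ)| ^ (-(a + 1 / (k + 1 : ℝ)))}.Infinite) :
    inhomExponent x θ ≤ a := by
  refine sSup_le ?_
  rintro _ ⟨w, -, rfl, hw⟩
  rw [EReal.coe_le_coe_iff]
  by_contra! hlt
  obtain ⟨k, hk⟩ := exists_nat_one_div_lt (sub_pos.2 hlt)
  refine h k (hw.mono ?_)
  rintro q ⟨hq0, hq⟩
  exact ⟨hq0, hq.trans_le (Real.rpow_le_rpow_of_exponent_le (one_le_abs_intCast hq0)
    (by linarith))⟩

theorem ae_inhomExponent_le (hd : 1 ≤ d) {U : Set (Fin d → ℝ)} (hU : IsOpen U)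
    (hdiff : ∀ u ∈ U, DifferentiableAt ℝ φ u)
    (hinj : ∀ u ∈ U, Function.Injective (fderiv ℝ φ u)) {a : ℝ} (ha : 0 ≤ a)
    (h : ∀ᵐ u ∂(volume.restrict U), simulExponent (φ u) ≤ a) :
    ∀ᵐ u ∂(volume.restrict U), inhomExponent (φ u) θ ≤ a := by
  have hall := ae_all_iff.2 fun k : ℕ => by
    have hk : (0 : ℝ) < 1 / (k + 1 : ℝ) := by positivity
    refine ae_not_infinite_of_ae_simulExponent_lt (θ := θ) hd hU hdiff hinj
      (v := a + 1 / (k + 1 : ℝ) / 2) (w := a + 1 / (k + 1 : ℝ)) (by positivity)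
      (by linarith) ?_
    filter_upwards [h] with u hu
    exact hu.trans_lt (EReal.coe_lt_coe_iff.2 (by linarith))
  filter_upwards [hall] with u hu
  exact inhomExponent_le_of_forall_not_infinite hu

end

/-! ### The equivalences. -/

theorem simulExponent_le_of_inhomExponent_zero_le {n : ℕ} {x : Fin n → ℝ} {a : ℝ} (ha : 0 ≤ a)
    (h : inhomExponent x 0 ≤ a) : simulExponent x ≤ a := by
  refine sSup_le ?_
  rintro _ ⟨w, rfl, hw⟩
  -- The inhomogeneous exponent only admits `w ≥ 0`; negative `w` are covered by `0 ≤ a`.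
  rcases le_or_gt 0 w with hw0 | hw0
  · suffices hmem : (w : EReal) ≤ inhomExponent x 0 from hmem.trans h
    refine le_sSup ⟨w, hw0, rfl, ?_⟩
    refine (hw.image (Nat.cast_injective (R := ℤ)).injOn).mono ?_
    rintro _ ⟨q, ⟨hq0, hq⟩, rfl⟩
    refine ⟨by exact_mod_cast hq0, ?_⟩
    simpa using hq
  · exact EReal.coe_le_coe_iff.2 (hw0.le.trans ha)

theorem isSIE_of_isSimulExtremal {n d : ℕ} (hn : 1 ≤ n) (hd : 1 ≤ d) {M : Set (Fin n → ℝ)}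
    (h : IsSimulExtremal d M) : IsSIE d M := by
  intro θ U φ hφ
  have hle := ae_inhomExponent_le (θ := θ) hd hφ.isOpen hφ.differentiableAt hφ.injective_fderiv
    (a := 1 / (n : ℝ)) (by positivity) ((h U φ hφ).mono fun u hu => hu.le)
  filter_upwards [hle, h U φ hφ] with u hu hsim
  exact le_antisymm hu (one_div_le_inhomExponent hn hsim.le θ)

theorem isSimulExtremal_of_isSIE {n d : ℕ} (hn : 1 ≤ n) {M : Set (Fin n → ℝ)}
    (h : IsSIE d M) : IsSimulExtremal d M := by
  intro U φ hφ
  filter_upwards [h 0 U φ hφ] with u hu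
  exact le_antisymm (simulExponent_le_of_inhomExponent_zero_le (by positivity) hu.le)
    (one_div_le_simulExponent hn (φ u))

theorem isExtremal_iff_isSimulExtremal {n d : ℕ} (hn : 1 ≤ n) {M : Set (Fin n → ℝ)} :
    IsExtremal d M ↔ IsSimulExtremal d M := by
  refine ⟨fun h U φ hφ => (h U φ hφ).mono fun u hu => hu.1, fun h U φ hφ => ?_⟩
  filter_upwards [h U φ hφ] with u hu
  exact ⟨hu, le_antisymm (dualExponent_le_of_simulExponent_le hn hu.le)
    (natCast_le_dualExponent hn (φ u))⟩

theorem theorem1 (n d : ℕ) (hn : 1 ≤ n) (hd : 1 ≤ d) (M : Set (Fin n → ℝ))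
    (hM : IsDifferentiableSubmanifold d M) :
    (IsExtremal d M ↔ IsSIE d M) ∧ (IsSimulExtremal d M ↔ IsSIE d M) := by
  have h : IsSimulExtremal d M ↔ IsSIE d M :=
    ⟨isSIE_of_isSimulExtremal hn hd, isSimulExtremal_of_isSIE hn⟩
  exact ⟨(isExtremal_iff_isSimulExtremal hn).trans h, h⟩
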